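/- All systems are finite-dimensional and $\log$ is to base $2$. For a density operator $\rho_{AB}$ put $$H_{\min}(A|B)_\rho=-\inf_{\sigma_B}\inf\{\lambda\in\mathbb R:\ \rho_{AB}\le 2^{\lambda}\,\mathsf{id}_A\otimes\sigma_B\},$$ where $\sigma_B$ ranges over the density operators on $B$. A cq-state, classical on $A$, is a state $\sum_a p_a|a\rangle\langle a|_A\otimes\rho_B^a$ with $(p_a)$ a probability distribution and $\rho^a_B$ density operators. A CPTP map $\Gamma:L(\mathcal A\otimes\mathcal B)\to L(\mathcal A\otimes\mathcal B')$ is classically controlled by $A$ if there are CPTP maps $\Gamma^a$ such that $\Gamma\big(\sum_a p_a|a\rangle\langle a|\otimes\rho^a\big)=\sum_a p_a|a\rangle\langle a|\otimes\Gamma^a(\rho^a)$ for every cq-state. Let $m\ge 0$, let $\rho_{A_0'B_0'}$ be a cq-state with $A_0'$ classical, and let Alice and Bob share the initial state $$\rho=|\Phi^+\rangle\langle\Phi^+|^{\otimes m}_{A_0''B_0''}\otimes\rho_{A_0'B_0'},\qquad |\Phi^+\rangle=\tfrac1{\sqrt2}(|00\rangle+|11\rangle),$$ where Alice holds $A_0'A_0''$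 and Bob holds $B_0=B_0'B_0''$. They run a protocol with $r\ge1$ rounds, with memory spaces $\mathcal A_1,\dots,\mathcal A_r$ and $\mathcal B_1,\dots,\mathcal B_r$ and message spaces $\mathcal X_1,\dots,\mathcal X_r$ (Alice to Bob) and $\mathcal Y_1,\dots,\mathcal Y_{r-1}$ (Bob to Alice). In turn, Alice applies $$\Phi_1:L(\mathcal A_0'\otimes\mathcal A_0'')\to L(\mathcal A_0'\otimes\mathcal A_1\otimes\mathcal X_1),\qquad \Phi_i:L(\mathcal A_0'\otimes\mathcal A_{i-1}\otimes\mathcal Y_{i-1})\to L(\mathcal A_0'\otimes\mathcal A_i\otimes\mathcal X_i)\quad(2\le i\le r),$$ all classically controlled by $A_0'$, and Bob applies CPTP maps $$\Psi_j:L(\mathcal B_{j-1}\otimes\mathcal X_j)\to L(\mathcal B_j\otimes\mathcal Y_j)\quad(1\le j\le r-1),\qquad \Psi_r:L(\mathcal B_{r-1}\otimes\mathcal X_r)\to L(\mathcal B_r),$$ in the order $\Phi_1,\Psi_1,\dots,\Phi_r,\Psi_r$. Let $m_A=\sum_{i=1}^r\log\dim\mathcal X_i$ and $m_B=\sum_{j=1}^{r-1}\log\dim\mathcal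 Y_j$, let $m_A\le m$, and let $\sigma_{A_0'A_rB_r}$ be the final state. Then $$H_{\min}(A_0'|B_r)_\sigma\ \ge\ H_{\min}(A_0'|B_0)_\rho-2m_A ,$$ whatever the value of $m_B$. -/

import Mathlib

open scoped Kronecker ComplexOrder

noncomputable section

namespace LeakageChain

/-- Linear maps `L(ℂ^I) → L(ℂ^J)`; a finite-dimensional system is given by the finite index type of
its computational basis, and the tensor product of two systems by the product of the index types. -/
abbrev SuperOp (I J : Type) : Type := Matrix I I ℂ →ₗ[ℂ] Matrix J J ℂ

/-- Density operators: positive semidefinite of trace one. -/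
def IsDensity {I : Type} [Fintype I] (ρ : Matrix I I ℂ) : Prop :=
  ρ.PosSemidef ∧ ρ.trace = 1

/-- Completely positive trace-preserving maps: `T(M) = ∑ₖ Eₖ M Eₖ†` with `∑ₖ Eₖ† Eₖ = id`. -/
def IsCPTP {I J : Type} [Fintype I] [DecidableEq I] [Fintype J] (T : SuperOp I J) : Prop :=
  ∃ (n : ℕ) (E : Fin n → Matrix J I ℂ),
    (∑ k, (E k).conjTranspose * E k = 1) ∧
      ∀ M : Matrix I I ℂ, T M = ∑ k, E k * M * (E k).conjTranspose

/-- The operator `∑ₐ pₐ |a⟩⟨a| ⊗ ρᵃ`. -/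
def cqOperator {C B : Type} [Fintype C] [DecidableEq C] (p : C → ℝ) (ρ : C → Matrix B B ℂ) :
    Matrix (C × B) (C × B) ℂ :=
  ∑ a, (p a : ℂ) • (Matrix.single a a (1 : ℂ) ⊗ₖ ρ a)

/-- Probability distributions on a finite set. -/
def IsProbability {C : Type} [Fintype C] (p : C → ℝ) : Prop :=
  (∀ a, 0 ≤ p a) ∧ ∑ a, p a = 1

/-- Classical-quantum states, classical on `C`. -/
def IsCQState {C B : Type} [Fintype C] [DecidableEq C] [Fintype B]
    (ρ : Matrix (C × B) (C × B) ℂ) : Prop :=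
  ∃ (p : C → ℝ) (ρB : C → Matrix B B ℂ),
    IsProbability p ∧ (∀ a, IsDensity (ρB a)) ∧ ρ = cqOperator p ρB

/-- A quantum operation on `C ⊗ B` is controlled by the classical system `C` if it sends every
cq-state `∑ₐ pₐ |a⟩⟨a| ⊗ ρᵃ` to `∑ₐ pₐ |a⟩⟨a| ⊗ Γᵃ(ρᵃ)`, for fixed CPTP maps `Γᵃ`. -/
def IsClassicallyControlled {C B B' : Type} [Fintype C] [DecidableEq C] [Fintype B] [DecidableEq B]
    [Fintype B'] (T : SuperOp (C × B) (C × B')) : Prop :=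
  IsCPTP T ∧ ∃ Γ : C → SuperOp B B', (∀ a, IsCPTP (Γ a)) ∧
    ∀ (p : C → ℝ) (ρ : C → Matrix B B ℂ), IsProbability p → (∀ a, IsDensity (ρ a)) →
      T (cqOperator p ρ) = cqOperator p (fun a => Γ a (ρ a))

/-- The action of `T ⊗ id_R`: `T` is applied to every block of the operator. -/
def tensorId {I J : Type} (R : Type) (T : SuperOp I J) (M : Matrix (I × R) (I × R) ℂ) :
    Matrix (J × R) (J × R) ℂ :=
  Matrix.of fun x y => T (Matrix.of fun i i' => M (i, x.2) (i', y.2)) x.1 y.1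

/-- The action of an operation of Alice (classical register `C`, workspace `A`) on a joint operator
on `C ⊗ A ⊗ B`, with the identity on Bob's system `B`; it outputs a memory `A'` and a message `X`,
the message being put on Bob's side. -/
def aliceStep {C A B A' X : Type} (T : SuperOp (C × A) (C × (A' × X)))
    (M : Matrix (C × A × B) (C × A × B) ℂ) :
    Matrix (C × A' × (B × X)) (C × A' × (B × X)) ℂ :=
  (tensorId B T (M.submatrix (fun x : (C × A) × B => (x.1.1, x.1.2, x.2))
      (fun x : (C × A) × B => (x.1.1, x.1.2, x.2)))).submatrix
    (fun x => ((x.1, (x.2.1, x.2.2.2)), x.2.2.1)) (fun x => ((x.1, (x.2.1, x.2.2.2)), x.2.2.1))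

/-- The action of an operation of Bob on a joint operator on `C ⊗ A ⊗ B`, with the identity on
Alice's systems `C ⊗ A`. -/
def bobStep {C A B B' : Type} (T : SuperOp B B')
    (M : Matrix (C × A × B) (C × A × B) ℂ) : Matrix (C × A × B') (C × A × B') ℂ :=
  (tensorId (C × A) T (M.submatrix (fun x : B × (C × A) => (x.2.1, x.2.2, x.1))
      (fun x : B × (C × A) => (x.2.1, x.2.2, x.1)))).submatrix
    (fun x => (x.2.2, (x.1, x.2.1))) (fun x => (x.2.2, (x.1, x.2.1)))

/-- Bob's message `Y` is handed over to Alice. -/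
def handOver {C A B Y : Type} (M : Matrix (C × A × (B × Y)) (C × A × (B × Y)) ℂ) :
    Matrix (C × (A × Y) × B) (C × (A × Y) × B) ℂ :=
  M.submatrix (fun x => (x.1, x.2.1.1, (x.2.2, x.2.1.2)))
    (fun x => (x.1, x.2.1.1, (x.2.2, x.2.1.2)))

/-- The quantum system on which Alice acts in round `i + 1`: her initial quantum system `A₀` for
`i = 0`, her memory `A_i` together with Bob's message `Y_i` for `i ≥ 1`. -/
def AliceIn (A₀ : Type) (dA dY : ℕ → ℕ) : ℕ → Type
  | 0 => A₀
  | i + 1 => Fin (dA (i + 1)) × Fin (dY (i + 1))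

instance AliceIn.instFintype (A₀ : Type) [Fintype A₀] (dA dY : ℕ → ℕ) :
    (i : ℕ) → Fintype (AliceIn A₀ dA dY i)
  | 0 => inferInstanceAs (Fintype A₀)
  | i + 1 => inferInstanceAs (Fintype (Fin (dA (i + 1)) × Fin (dY (i + 1))))

instance AliceIn.instDecidableEq (A₀ : Type) [DecidableEq A₀] (dA dY : ℕ → ℕ) :
    (i : ℕ) → DecidableEq (AliceIn A₀ dA dY i)
  | 0 => inferInstanceAs (DecidableEq A₀)
  | i + 1 => inferInstanceAs (DecidableEq (Fin (dA (i + 1)) × Fin (dY (i + 1))))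

/-- Bob's memory `B_j`: his input system `B₀` for `j = 0`, of dimension `dB j` for `j ≥ 1`. -/
def BobMem (B₀ : Type) (dB : ℕ → ℕ) : ℕ → Type
  | 0 => B₀
  | j + 1 => Fin (dB (j + 1))

instance BobMem.instFintype (B₀ : Type) [Fintype B₀] (dB : ℕ → ℕ) :
    (j : ℕ) → Fintype (BobMem B₀ dB j)
  | 0 => inferInstanceAs (Fintype B₀)
  | j + 1 => inferInstanceAs (Fintype (Fin (dB (j + 1))))

instance BobMem.instDecidableEq (B₀ : Type) [DecidableEq B₀] (dB : ℕ → ℕ) :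
    (j : ℕ) → DecidableEq (BobMem B₀ dB j)
  | 0 => inferInstanceAs (DecidableEq B₀)
  | j + 1 => inferInstanceAs (DecidableEq (Fin (dB (j + 1))))

/-- Two-party protocols with `r = n + 1` rounds (so `r ≥ 1`; Alice sends the first and the last
message) in which Alice's operations are controlled by her classical register `C`, which is
preserved. Initially Alice holds `C` and a quantum system `A₀`, and Bob holds `B₀`. The memory spaces
`A_i`, `B_i` and the message spaces `X_i` (Alice to Bob), `Y_i` (Bob to Alice) have the dimensions
`dA i`, `dB i`, `dX i`, `dY i` for `i ≥ 1`. `Φ i` is Alice's operation in round `i + 1` and `Ψ j`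
Bob's operation in round `j + 1 < r`; in the last round Bob applies `Ψlast` and sends nothing.
Entries for other indices play no role. -/
structure Protocol (C A₀ B₀ : Type) [Fintype C] [DecidableEq C] [Fintype A₀] [DecidableEq A₀]
    [Fintype B₀] [DecidableEq B₀] (n : ℕ) where
  dA : ℕ → ℕ
  dB : ℕ → ℕ
  dX : ℕ → ℕ
  dY : ℕ → ℕ
  Φ : (i : ℕ) → SuperOp (C × AliceIn A₀ dA dY i) (C × (Fin (dA (i + 1)) × Fin (dX (i + 1))))
  Ψ : (j : ℕ) → SuperOp (BobMem B₀ dB j × Fin (dX (j + 1)))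
    (Fin (dB (j + 1)) × Fin (dY (j + 1)))
  Ψlast : SuperOp (BobMem B₀ dB n × Fin (dX (n + 1))) (Fin (dB (n + 1)))
  controlled : ∀ i ≤ n, IsClassicallyControlled (Φ i)
  cptp : ∀ j < n, IsCPTP (Ψ j)
  cptp_last : IsCPTP Ψlast

namespace Protocol

/-- The joint operator after the first `k` rounds and the delivery of Bob's message `Y_k`. -/
def stateAfter {C A₀ B₀ : Type} [Fintype C] [DecidableEq C] [Fintype A₀] [DecidableEq A₀]
    [Fintype B₀] [DecidableEq B₀] {n : ℕ} (P : Protocol C A₀ B₀ n)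
    (M : Matrix (C × A₀ × B₀) (C × A₀ × B₀) ℂ) :
    (k : ℕ) → Matrix (C × AliceIn A₀ P.dA P.dY k × BobMem B₀ P.dB k)
      (C × AliceIn A₀ P.dA P.dY k × BobMem B₀ P.dB k) ℂ
  | 0 => M
  | k + 1 => handOver (bobStep (P.Ψ k) (aliceStep (P.Φ k) (P.stateAfter M k)))

/-- The joint operator on `C ⊗ A_r ⊗ B_r` at the end of the protocol, where `r = n + 1`. -/
def run {C A₀ B₀ : Type} [Fintype C] [DecidableEq C] [Fintype A₀] [DecidableEq A₀]
    [Fintype B₀] [DecidableEq B₀] {n : ℕ} (P : Protocol C A₀ B₀ n)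
    (M : Matrix (C × A₀ × B₀) (C × A₀ × B₀) ℂ) :
    Matrix (C × Fin (P.dA (n + 1)) × Fin (P.dB (n + 1)))
      (C × Fin (P.dA (n + 1)) × Fin (P.dB (n + 1))) ℂ :=
  bobStep P.Ψlast (aliceStep (P.Φ n) (P.stateAfter M n))

/-- The number `∑_{i=1}^r log₂ dim X_i` of qubits sent from Alice to Bob. -/
def commA {C A₀ B₀ : Type} [Fintype C] [DecidableEq C] [Fintype A₀] [DecidableEq A₀]
    [Fintype B₀] [DecidableEq B₀] {n : ℕ} (P : Protocol C A₀ B₀ n) : ℝ :=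
  ∑ i ∈ Finset.range (n + 1), Real.logb 2 (P.dX (i + 1))

/-- The number `∑_{j=1}^{r-1} log₂ dim Y_j` of qubits sent from Bob to Alice. -/
def commB {C A₀ B₀ : Type} [Fintype C] [DecidableEq C] [Fintype A₀] [DecidableEq A₀]
    [Fintype B₀] [DecidableEq B₀] {n : ℕ} (P : Protocol C A₀ B₀ n) : ℝ :=
  ∑ j ∈ Finset.range n, Real.logb 2 (P.dY (j + 1))

end Protocol

/-- Partial trace over Alice's quantum system: `C ⊗ A ⊗ B` to `C ⊗ B`. -/
def traceAlice {C A B : Type} [Fintype A] (M : Matrix (C × A × B) (C × A × B) ℂ) :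
    Matrix (C × B) (C × B) ℂ :=
  Matrix.of fun x y => ∑ a, M (x.1, a, x.2) (y.1, a, y.2)

/-- The conditional min-entropy `H_min(A|B)_ρ`: minus the infimum of all real `l` such that
`ρ ≤ 2^l • (id_A ⊗ σ)` for some density operator `σ` on `B`. For a density operator `ρ` this set
is nonempty and bounded below, so the infimum is the one over `σ` of the infima over `l`. -/
def minEntropy {A B : Type} [Fintype A] [DecidableEq A] [Fintype B]
    (ρ : Matrix (A × B) (A × B) ℂ) : ℝ :=
  -sInf {l : ℝ | ∃ σ : Matrix B B ℂ, IsDensity σ ∧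
    ((((2 : ℝ) ^ l : ℝ) : ℂ) • ((1 : Matrix A A ℂ) ⊗ₖ σ) - ρ).PosSemidef}

/-- The computational basis of `m` qubits. -/
abbrev Qubits (m : ℕ) : Type := Fin m → Fin 2

/-- The vector `(|00⟩ + |11⟩) / √2`. -/
def eprVector : Fin 2 × Fin 2 → ℂ :=
  fun x => if x.1 = x.2 then ((Real.sqrt 2 : ℝ) : ℂ)⁻¹ else 0

/-- The density operator of `m` EPR pairs; the `k`-th pair consists of the `k`-th qubit of either
side. -/
def eprPairs (m : ℕ) : Matrix (Qubits m × Qubits m) (Qubits m × Qubits m) ℂ :=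
  Matrix.vecMulVec (fun x => ∏ k, eprVector (x.1 k, x.2 k))
    (star fun x => ∏ k, eprVector (x.1 k, x.2 k))

/-- The initial state: `m` EPR pairs tensored with `ρ`. Alice holds `C` and one half of each pair,
Bob holds `B` and the other halves. -/
def initialState {C B : Type} (m : ℕ) (ρ : Matrix (C × B) (C × B) ℂ) :
    Matrix (C × Qubits m × (B × Qubits m)) (C × Qubits m × (B × Qubits m)) ℂ :=
  (eprPairs m ⊗ₖ ρ).submatrix (fun x => ((x.2.1, x.2.2.2), (x.1, x.2.2.1)))
    (fun x => ((x.2.1, x.2.2.2), (x.1, x.2.2.1)))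

end LeakageChain

end

namespace LeakageChain

open scoped Kronecker ComplexOrder

/-! The proof follows one invariant, `IsCQBounded s`: the joint state is block diagonal in the
classical register, and the marginal of every block on Bob's side is at most `s • σ` for a common
density operator `σ`. At `s = 2 ^ l` this says that `l` is admissible in the min-entropy of the
register given Bob.

Bob's operations map `σ` along with the state, and handing his message to Alice only traces out part
of his system; neither changes `s`, which is why `m_B` does not enter. When Alice sends `X` of
dimension `d`, trace preservation keeps the marginal on Bob's old memory fixed in each block
(`traceSnd_traceFst_aliceBlock`). The new marginal `M` on `B ⊗ X` obeys `M ≤ d • tr_X M ⊗ id`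
(`posSemidef_card_smul_traceSnd_kronecker_one_sub`), hence `M ≤ d s • σ ⊗ id = d² s • (σ ⊗ id/d)`.
Each message thus costs `d²`, and the product over the rounds is `2 ^ (2 m_A)`. Classical control is
what makes the blockwise argument possible. -/

/-- The operator `∑ₐ |a⟩⟨a| ⊗ Nᵃ`. -/
noncomputable def cqBlock {C K : Type} [DecidableEq C] (N : C → Matrix K K ℂ) :
    Matrix (C × K) (C × K) ℂ :=
  Matrix.of fun x y => if x.1 = y.1 then N x.1 x.2 y.2 else 0

/-! ### Block-diagonal (classical-quantum) operators. -/

section CQBlock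

variable {C K : Type} [DecidableEq C]

lemma cqBlock_apply (N : C → Matrix K K ℂ) (x y : C × K) :
    cqBlock N x y = if x.1 = y.1 then N x.1 x.2 y.2 else 0 := rfl

lemma sum_single_kronecker [Fintype C] (N : C → Matrix K K ℂ) :
    ∑ a, Matrix.single a a (1 : ℂ) ⊗ₖ N a = cqBlock N := by
  ext ⟨c, k⟩ ⟨c', k'⟩
  simp only [Matrix.sum_apply, Matrix.kroneckerMap_apply, cqBlock_apply, Matrix.single_apply]
  rw [Finset.sum_eq_single c]
  · by_cases h : c = c' <;> simp [h]
  · intro b _ hb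
    simp [hb]
  · simp

lemma cqOperator_eq_cqBlock [Fintype C] (p : C → ℝ) (ρ : C → Matrix K K ℂ) :
    cqOperator p ρ = cqBlock fun a => (p a : ℂ) • ρ a := by
  rw [← sum_single_kronecker, cqOperator]
  simp only [Matrix.kronecker_smul]

lemma smul_one_kronecker_sub_cqBlock [Fintype C] (s : ℂ) (σ : Matrix K K ℂ)
    (N : C → Matrix K K ℂ) :
    s • ((1 : Matrix C C ℂ) ⊗ₖ σ) - cqBlock N = cqBlock fun c => s • σ - N c := by
  ext ⟨c, k⟩ ⟨c', k'⟩
  by_cases h : c = c' <;> simp [cqBlock_apply, h]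

lemma posSemidef_block_of_posSemidef_cqBlock {N : C → Matrix K K ℂ}
    (h : (cqBlock N).PosSemidef) (c : C) : (N c).PosSemidef := by
  have := h.submatrix (fun k : K => (c, k))
  convert this using 1
  ext k k'
  simp [cqBlock_apply]

lemma posSemidef_cqBlock [Fintype C] [Fintype K] {N : C → Matrix K K ℂ}
    (h : ∀ c, (N c).PosSemidef) : (cqBlock N).PosSemidef := by
  rw [← sum_single_kronecker]
  refine Matrix.posSemidef_sum _ fun c _ => Matrix.PosSemidef.kronecker ?_ (h c)
  rw [← Matrix.diagonal_single]
  refine Matrix.PosSemidef.diagonal ?_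
  intro i
  by_cases hi : i = c
  · subst hi; simp
  · simp [hi]

lemma trace_cqBlock [Fintype C] [Fintype K] (N : C → Matrix K K ℂ) :
    (cqBlock N).trace = ∑ c, (N c).trace := by
  simp [Matrix.trace, Fintype.sum_prod_type, cqBlock_apply]

end CQBlock

/-! ### Positivity and trace under CPTP maps. -/

section CPTP

variable {I J R : Type} [Fintype I] [DecidableEq I] [Fintype J]

lemma IsCPTP.trace_eq {T : SuperOp I J} (hT : IsCPTP T) (M : Matrix I I ℂ) :
    (T M).trace = M.trace := by
  obtain ⟨n, E, hE, h⟩ := hT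
  rw [h, Matrix.trace_sum]
  have : ∀ k, (E k * M * (E k).conjTranspose).trace
      = ((E k).conjTranspose * E k * M).trace := fun k => by
    rw [Matrix.trace_mul_comm, Matrix.mul_assoc]
  simp only [this]
  rw [← Matrix.trace_sum, ← Finset.sum_mul, hE, Matrix.one_mul]

lemma IsCPTP.posSemidef {T : SuperOp I J} (hT : IsCPTP T) {M : Matrix I I ℂ}
    (hM : M.PosSemidef) : (T M).PosSemidef := by
  obtain ⟨n, E, hE, h⟩ := hT
  rw [h]
  exact Matrix.posSemidef_sum _ fun k _ => hM.mul_mul_conjTranspose_same _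

lemma IsCPTP.isDensity {T : SuperOp I J} (hT : IsCPTP T) {M : Matrix I I ℂ}
    (hM : IsDensity M) : IsDensity (T M) :=
  ⟨hT.posSemidef hM.1, by rw [hT.trace_eq, hM.2]⟩

/-- Complete positivity: `T ⊗ id` preserves positivity. -/
lemma IsCPTP.posSemidef_tensorId [Fintype R] [DecidableEq R] {T : SuperOp I J} (hT : IsCPTP T)
    {M : Matrix (I × R) (I × R) ℂ} (hM : M.PosSemidef) : (tensorId R T M).PosSemidef := by
  obtain ⟨n, E, hE, h⟩ := hT
  have : tensorId R T M = ∑ k, (E k ⊗ₖ (1 : Matrix R R ℂ)) * M *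
      (E k ⊗ₖ (1 : Matrix R R ℂ)).conjTranspose := by
    ext ⟨j, x⟩ ⟨j', y⟩
    simp only [tensorId, Matrix.of_apply, h, Matrix.sum_apply, Matrix.mul_apply,
      Matrix.conjTranspose_apply, Matrix.kroneckerMap_apply, Fintype.sum_prod_type,
      Matrix.one_apply, star_mul', apply_ite star, star_one, star_zero]
    simp
  rw [this]
  exact Matrix.posSemidef_sum _ fun k _ => hM.mul_mul_conjTranspose_same _

end CPTP

/-! ### Extending classical control from states to all block-diagonal operators. -/

section Span

open scoped Matrix.Norms.L2Operator MatrixOrder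

/-- Linear maps that agree on density operators are equal. -/
lemma linearMap_ext_density {I E : Type} [Fintype I] [DecidableEq I] [AddCommGroup E] [Module ℂ E]
    {S T : Matrix I I ℂ →ₗ[ℂ] E} (h : ∀ ρ, IsDensity ρ → S ρ = T ρ) : S = T := by
  refine LinearMap.ext_on (CStarAlgebra.span_nonneg (A := Matrix I I ℂ)) fun M hM => ?_
  have hM : M.PosSemidef := Matrix.nonneg_iff_posSemidef.mp hM
  -- Positive operators span; each is zero or a multiple of a density operator.
  by_cases h0 : M.trace = 0
  · rw [hM.trace_eq_zero_iff.mp h0, map_zero, map_zero]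
  · have hd : IsDensity ((M.trace)⁻¹ • M) := by
      refine ⟨hM.smul (inv_nonneg.mpr hM.trace_nonneg), ?_⟩
      rw [Matrix.trace_smul, smul_eq_mul, inv_mul_cancel₀ h0]
    have := h _ hd
    rw [map_smul, map_smul] at this
    exact smul_right_injective _ (inv_ne_zero h0) this

end Span

/-- A classically controlled operation acts blockwise on all operators that are classical on the
control register. -/
lemma IsClassicallyControlled.exists_cqBlock {C B B' : Type} [Fintype C] [DecidableEq C]
    [Fintype B] [DecidableEq B] [Fintype B'] {T : SuperOp (C × B) (C × B')}
    (hT : IsClassicallyControlled T) :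
    ∃ Γ : C → SuperOp B B', (∀ a, IsCPTP (Γ a)) ∧
      ∀ N : C → Matrix B B ℂ, T (cqBlock N) = cqBlock fun a => Γ a (N a) := by
  obtain ⟨-, Γ, hΓ, h⟩ := hT
  refine ⟨Γ, hΓ, fun N => ?_⟩
  have key : ∀ a, T ∘ₗ Matrix.kroneckerBilinear (R := ℂ) (Matrix.single a a (1 : ℂ)) =
      Matrix.kroneckerBilinear (R := ℂ) (Matrix.single a a (1 : ℂ)) ∘ₗ Γ a := by
    intro a
    refine linearMap_ext_density fun ρ hρ => ?_
    -- The point mass at `a` isolates the block `a` in the definition of control.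
    have hp : IsProbability (Pi.single a (1 : ℝ)) := by
      refine ⟨fun b => ?_, by simp⟩
      by_cases hb : b = a
      · subst hb; simp
      · simp [hb]
    have e := h (Pi.single a 1) (fun _ => ρ) hp fun _ => hρ
    have hs : ∀ {K : Type} (σ : C → Matrix K K ℂ), cqOperator (Pi.single a (1 : ℝ)) σ =
        Matrix.single a a (1 : ℂ) ⊗ₖ σ a := fun σ => by
      rw [cqOperator, Finset.sum_eq_single a]
      · simp
      · intro b _ hb
        simp [hb]
      · simp
    rw [hs, hs] at e
    exact e
  rw [← sum_single_kronecker, map_sum, ← sum_single_kronecker]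
  exact Finset.sum_congr rfl fun a _ => LinearMap.congr_fun (key a) (N a)

/-! ### Partial traces and the dimension bound. -/

section PartialTrace

variable {A B X : Type}

/-- Partial trace over the first factor. -/
noncomputable def traceFst [Fintype A] (M : Matrix (A × B) (A × B) ℂ) : Matrix B B ℂ :=
  Matrix.of fun x y => ∑ a, M (a, x) (a, y)

/-- Partial trace over the second factor. -/
noncomputable def traceSnd [Fintype X] (M : Matrix (B × X) (B × X) ℂ) : Matrix B B ℂ :=
  Matrix.of fun x y => ∑ a, M (x, a) (y, a)

lemma traceFst_posSemidef [Fintype A] {M : Matrix (A × B) (A × B) ℂ}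
    (hM : M.PosSemidef) : (traceFst M).PosSemidef := by
  have : traceFst M = ∑ a, M.submatrix (fun b => (a, b)) (fun b => (a, b)) := by
    ext; simp [traceFst, Matrix.sum_apply]
  rw [this]
  exact Matrix.posSemidef_sum _ fun a _ => hM.submatrix _

lemma traceSnd_posSemidef [Fintype X] {M : Matrix (B × X) (B × X) ℂ}
    (hM : M.PosSemidef) : (traceSnd M).PosSemidef := by
  have : traceSnd M = ∑ a, M.submatrix (fun b => (b, a)) (fun b => (b, a)) := by
    ext; simp [traceSnd, Matrix.sum_apply]
  rw [this]
  exact Matrix.posSemidef_sum _ fun a _ => hM.submatrix _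

lemma trace_traceFst [Fintype A] [Fintype B] (M : Matrix (A × B) (A × B) ℂ) :
    (traceFst M).trace = M.trace := by
  simp only [Matrix.trace, traceFst, Matrix.diag_apply, Matrix.of_apply, Fintype.sum_prod_type]
  exact Finset.sum_comm

lemma trace_traceSnd [Fintype X] [Fintype B] (M : Matrix (B × X) (B × X) ℂ) :
    (traceSnd M).trace = M.trace := by
  simp only [Matrix.trace, traceSnd, Matrix.diag_apply, Matrix.of_apply, Fintype.sum_prod_type]

lemma traceAlice_cqBlock {C : Type} [DecidableEq C] [Fintype A]
    (N : C → Matrix (A × B) (A × B) ℂ) :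
    traceAlice (cqBlock N) = cqBlock fun c => traceFst (N c) := by
  ext ⟨c, b⟩ ⟨c', b'⟩
  by_cases h : c = c' <;> simp [traceAlice, cqBlock_apply, traceFst, h]

lemma dotProduct_conjTranspose_mul_self_mulVec {I J : Type} [Fintype I] [Fintype J]
    (L : Matrix J I ℂ) (v : I → ℂ) :
    star v ⬝ᵥ (L.conjTranspose * L).mulVec v = ((∑ k, ‖L.mulVec v k‖ ^ 2 : ℝ) : ℂ) := by
  rw [← Matrix.mulVec_mulVec, Matrix.dotProduct_mulVec, ← Matrix.star_mulVec, dotProduct]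
  push_cast
  refine Finset.sum_congr rfl fun k _ => ?_
  rw [Pi.star_apply, ← Complex.conj_mul', starRingEnd_apply]

/-- `M ≤ dim X · tr_X M ⊗ id_X` for positive `M` on `B ⊗ X`. -/
lemma posSemidef_card_smul_traceSnd_kronecker_one_sub [Fintype B] [DecidableEq B] [Fintype X]
    [DecidableEq X] {M : Matrix (B × X) (B × X) ℂ} (hM : M.PosSemidef) :
    ((Fintype.card X : ℂ) • (traceSnd M ⊗ₖ (1 : Matrix X X ℂ)) - M).PosSemidef := by
  have hM' := hM
  obtain ⟨L, rfl⟩ : ∃ L : Matrix (B × X) (B × X) ℂ, M = L.conjTranspose * L := by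
    open scoped Matrix.Norms.L2Operator MatrixOrder in
    obtain ⟨L, hL⟩ := CStarAlgebra.nonneg_iff_eq_star_mul_self.mp
      (Matrix.nonneg_iff_posSemidef.mpr hM)
    exact ⟨L, hL⟩
  have hH : ((Fintype.card X : ℂ) • (traceSnd (L.conjTranspose * L) ⊗ₖ (1 : Matrix X X ℂ)) -
      L.conjTranspose * L).IsHermitian :=
    (((traceSnd_posSemidef hM').kronecker Matrix.PosSemidef.one).smul
      (Nat.cast_nonneg _)).isHermitian.sub hM'.isHermitian
  refine Matrix.PosSemidef.of_dotProduct_mulVec_nonneg hH fun v => ?_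
  -- With `M = L† L`, the form of `M` at `v` sees only the diagonal sums `∑ x, w k x x`, while that
  -- of `tr_X M ⊗ id` is the sum of all `‖w k x y‖²`. Cauchy–Schwarz on the diagonal then costs the
  -- factor `card X`.
  set w : B × X → X → X → ℂ := fun k x y => ∑ b, L k (b, y) * v (b, x) with hw
  have h₁ : star v ⬝ᵥ (L.conjTranspose * L).mulVec v =
      ((∑ k, ‖∑ x, w k x x‖ ^ 2 : ℝ) : ℂ) := by
    rw [dotProduct_conjTranspose_mul_self_mulVec]
    congr! with k
    rw [hw, Matrix.mulVec, dotProduct, Fintype.sum_prod_type, Finset.sum_comm]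
  have h₂ : star v ⬝ᵥ (traceSnd (L.conjTranspose * L) ⊗ₖ (1 : Matrix X X ℂ)).mulVec v =
      ((∑ k, ∑ x, ∑ y, ‖w k x y‖ ^ 2 : ℝ) : ℂ) := by
    -- Chosen so that `G v` has the entries `w k x y`.
    set G : Matrix ((B × X) × X × X) (B × X) ℂ :=
      Matrix.of fun k z => if k.2.1 = z.2 then L k.1 (z.1, k.2.2) else 0 with hG
    have hGG : traceSnd (L.conjTranspose * L) ⊗ₖ (1 : Matrix X X ℂ) = G.conjTranspose * G := by
      ext ⟨b, x⟩ ⟨b', x'⟩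
      simp only [hG, traceSnd, Matrix.mul_apply, Matrix.conjTranspose_apply,
        Matrix.kroneckerMap_apply, Matrix.of_apply, Matrix.one_apply,
        Fintype.sum_prod_type (α₁ := B × X), Fintype.sum_prod_type (α₁ := X)]
      rw [Finset.sum_comm, Finset.sum_mul]
      refine Finset.sum_congr rfl fun k _ => Eq.symm ?_
      rw [Finset.sum_eq_single x (fun z _ hz => by simp [hz]) (by simp)]
      rcases eq_or_ne x x' with rfl | h
      · simp
      · simp [h]
    rw [hGG, dotProduct_conjTranspose_mul_self_mulVec, Fintype.sum_prod_type]
    simp only [Fintype.sum_prod_type (α₁ := X)]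
    congr! with k _ x _ y
    simp [hG, hw, Matrix.mulVec, dotProduct, Fintype.sum_prod_type]
  rw [Matrix.sub_mulVec, Matrix.smul_mulVec, dotProduct_sub, dotProduct_smul, h₁, h₂, smul_eq_mul,
    sub_nonneg]
  norm_cast
  rw [Finset.mul_sum]
  refine Finset.sum_le_sum fun k _ => ?_
  calc ‖∑ x, w k x x‖ ^ 2 ≤ (∑ x, ‖w k x x‖) ^ 2 := by gcongr; exact norm_sum_le _ _
    _ ≤ Fintype.card X * ∑ x, ‖w k x x‖ ^ 2 := sq_sum_le_card_mul_sum_sq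
    _ ≤ Fintype.card X * ∑ x, ∑ y, ‖w k x y‖ ^ 2 := by
      gcongr with x
      exact Finset.single_le_sum (f := fun y => ‖w k x y‖ ^ 2) (fun y _ => by positivity)
        (Finset.mem_univ x)

end PartialTrace

/-! ### The protocol steps on blocks and on Bob's marginals. -/

section Steps

variable {C A B A' B' X Y : Type} [DecidableEq C]

/-- One block of `aliceStep`. -/
noncomputable def aliceBlock (T : SuperOp A (A' × X)) (M : Matrix (A × B) (A × B) ℂ) :
    Matrix (A' × (B × X)) (A' × (B × X)) ℂ :=
  (tensorId B T M).submatrix (fun x => ((x.1, x.2.2), x.2.1)) fun x => ((x.1, x.2.2), x.2.1)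

/-- One block of `bobStep`. -/
noncomputable def bobBlock (T : SuperOp B B') (M : Matrix (A × B) (A × B) ℂ) :
    Matrix (A × B') (A × B') ℂ :=
  (tensorId A T (M.submatrix Prod.swap Prod.swap)).submatrix Prod.swap Prod.swap

lemma aliceStep_cqBlock {T : SuperOp (C × A) (C × (A' × X))} {Γ : C → SuperOp A (A' × X)}
    (hT : ∀ N : C → Matrix A A ℂ, T (cqBlock N) = cqBlock fun a => Γ a (N a))
    (N : C → Matrix (A × B) (A × B) ℂ) :
    aliceStep T (cqBlock N) = cqBlock fun c => aliceBlock (Γ c) (N c) := by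
  ext ⟨c, a, b, x⟩ ⟨c', a', b', x'⟩
  have := hT fun c => Matrix.of fun i i' => N c (i, b) (i', b')
  exact congrFun (congrFun this (c, a, x)) (c', a', x')

lemma bobStep_cqBlock (T : SuperOp B B') (N : C → Matrix (A × B) (A × B) ℂ) :
    bobStep T (cqBlock N) = cqBlock fun c => bobBlock T (N c) := by
  ext ⟨c, a, b⟩ ⟨c', a', b'⟩
  simp only [bobStep, bobBlock, tensorId, cqBlock_apply, Matrix.submatrix_apply, Matrix.of_apply,
    Prod.swap]
  by_cases h : c = c'
  · simp [h]
  · simp only [h, if_false]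
    exact congrFun (congrFun (map_zero T) b) b'

lemma handOver_cqBlock (N : C → Matrix (A × (B × Y)) (A × (B × Y)) ℂ) :
    handOver (cqBlock N) = cqBlock fun c => (N c).submatrix
      (fun x : (A × Y) × B => (x.1.1, (x.2, x.1.2))) fun x => (x.1.1, (x.2, x.1.2)) := rfl

/-- Linearity alone suffices: the trace over Alice is a sum of blocks on which `T` acts. -/
lemma traceFst_bobBlock [Fintype A] (T : SuperOp B B') (M : Matrix (A × B) (A × B) ℂ) :
    traceFst (bobBlock T M) = T (traceFst M) := by
  have : traceFst M = ∑ a, Matrix.of fun b b' => M (a, b) (a, b') := by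
    ext; simp [traceFst, Matrix.sum_apply]
  rw [this, map_sum]
  ext b b'
  simp [traceFst, bobBlock, tensorId, Matrix.sum_apply]

/-- No signalling: before the message is read, a trace-preserving map of Alice is invisible to Bob.
-/
lemma traceSnd_traceFst_aliceBlock [Fintype A] [DecidableEq A] [Fintype A'] [Fintype X]
    {T : SuperOp A (A' × X)} (hT : IsCPTP T) (M : Matrix (A × B) (A × B) ℂ) :
    traceSnd (traceFst (aliceBlock T M)) = traceFst M := by
  ext b b'
  have := hT.trace_eq (Matrix.of fun i i' => M (i, b) (i', b'))
  simp only [Matrix.trace, Fintype.sum_prod_type] at this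
  rw [Finset.sum_comm] at this
  exact this

lemma traceFst_handOver [Fintype A] [Fintype Y] (M : Matrix (A × (B × Y)) (A × (B × Y)) ℂ) :
    traceFst (M.submatrix (fun x : (A × Y) × B => (x.1.1, (x.2, x.1.2)))
      fun x => (x.1.1, (x.2, x.1.2))) = traceSnd (traceFst M) := by
  ext b b'
  simp only [traceFst, traceSnd, Matrix.of_apply, Matrix.submatrix_apply, Fintype.sum_prod_type]
  exact Finset.sum_comm

lemma traceSnd_smul_sub [Fintype X] (s : ℂ) (M N : Matrix (B × X) (B × X) ℂ) :
    traceSnd (s • M - N) = s • traceSnd M - traceSnd N := by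
  ext; simp [traceSnd, Finset.mul_sum]

end Steps

/-! ### The invariant and its change in each step. -/

/-- `M` is a state on `C ⊗ A ⊗ B`, classical on `C`, whose marginal on `C ⊗ B` is at most
`s • (id_C ⊗ σ)` for some density operator `σ` on `B`. -/
def IsCQBounded {C A B : Type} [Fintype C] [DecidableEq C] [Fintype A] [Fintype B] (s : ℝ)
    (M : Matrix (C × A × B) (C × A × B) ℂ) : Prop :=
  ∃ N : C → Matrix (A × B) (A × B) ℂ, M = cqBlock N ∧ (∀ c, (N c).PosSemidef) ∧
    ∑ c, (N c).trace = 1 ∧ ∃ σ : Matrix B B ℂ, IsDensity σ ∧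
      ∀ c, ((s : ℂ) • σ - traceFst (N c)).PosSemidef

namespace IsCQBounded

variable {C A B A' B' X Y : Type} [Fintype C] [DecidableEq C] [Fintype A] [Fintype B] {s : ℝ} {M : Matrix (C × A × B) (C × A × B) ℂ}

lemma aliceStep [DecidableEq A] [DecidableEq B] [Fintype A'] [Fintype X] [DecidableEq X]
    {T : SuperOp (C × A) (C × (A' × X))} (hT : IsClassicallyControlled T) (hM : IsCQBounded s M) :
    Nonempty X ∧ IsCQBounded ((Fintype.card X : ℝ) ^ 2 * s) (aliceStep T M) := by
  obtain ⟨N, rfl, hN, htr, σ, hσ, hle⟩ := hM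
  obtain ⟨Γ, hΓ, h⟩ := hT.exists_cqBlock
  have htrace : ∀ c, (aliceBlock (Γ c) (N c)).trace = (N c).trace := fun c => by
    rw [← trace_traceFst, ← trace_traceSnd, traceSnd_traceFst_aliceBlock (hΓ c), trace_traceFst]
  -- An empty message space would force total trace zero; nonemptiness allows division by `card X`.
  have hX : Nonempty X := by
    by_contra hX
    rw [not_nonempty_iff] at hX
    simp only [← htrace] at htr
    simp [Matrix.trace] at htr
  have hd : (Fintype.card X : ℂ) ≠ 0 := by simp
  have hpos : ∀ c, (aliceBlock (Γ c) (N c)).PosSemidef := fun c =>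
    ((hΓ c).posSemidef_tensorId (hN c)).submatrix _
  -- The new reference state puts the maximally mixed state on the message; its normalization is the
  -- second factor `card X`.
  refine ⟨hX, fun c => aliceBlock (Γ c) (N c), aliceStep_cqBlock h N, hpos, by simpa only [htrace],
    (Fintype.card X : ℂ)⁻¹ • (σ ⊗ₖ (1 : Matrix X X ℂ)), ⟨?_, ?_⟩, fun c => ?_⟩
  · exact (hσ.1.kronecker Matrix.PosSemidef.one).smul (inv_nonneg.mpr (Nat.cast_nonneg _))
  · rw [Matrix.trace_smul, Matrix.trace_kronecker, hσ.2, Matrix.trace_one, one_mul, smul_eq_mul,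
      inv_mul_cancel₀ hd]
  · have h₁ := posSemidef_card_smul_traceSnd_kronecker_one_sub (traceFst_posSemidef (hpos c))
    rw [traceSnd_traceFst_aliceBlock (hΓ c)] at h₁
    have h₂ := ((hle c).kronecker (Matrix.PosSemidef.one (n := X) (R := ℂ))).smul
      (Nat.cast_nonneg (α := ℂ) (Fintype.card X))
    have hsub : ∀ K L : Matrix B B ℂ, (K - L) ⊗ₖ (1 : Matrix X X ℂ) =
        K ⊗ₖ (1 : Matrix X X ℂ) - L ⊗ₖ (1 : Matrix X X ℂ) := fun K L => by
      ext; simp [sub_mul]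
    rw [hsub, Matrix.smul_kronecker, smul_sub] at h₂
    have h₃ := h₂.add h₁
    rw [sub_add_sub_cancel, smul_smul] at h₃
    have e : (((Fintype.card X : ℝ) ^ 2 * s : ℝ) : ℂ) * (Fintype.card X : ℂ)⁻¹ =
        Fintype.card X * s := by
      push_cast
      field_simp
    rwa [smul_smul, e]

lemma bobStep [DecidableEq A] [DecidableEq B] [Fintype B'] {T : SuperOp B B'} (hT : IsCPTP T)
    (hM : IsCQBounded s M) : IsCQBounded s (bobStep T M) := by
  obtain ⟨N, rfl, hN, htr, σ, hσ, hle⟩ := hM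
  refine ⟨fun c => bobBlock T (N c), bobStep_cqBlock T N, fun c => ?_, ?_, T σ, hT.isDensity hσ,
    fun c => ?_⟩
  · exact (hT.posSemidef_tensorId ((hN c).submatrix _)).submatrix _
  · rw [← htr]
    refine Finset.sum_congr rfl fun c _ => ?_
    rw [← trace_traceFst, traceFst_bobBlock, hT.trace_eq, trace_traceFst]
  · rw [traceFst_bobBlock, ← map_smul, ← map_sub]
    exact hT.posSemidef (hle c)

lemma handOver [Fintype Y] {M : Matrix (C × A × (B × Y)) (C × A × (B × Y)) ℂ}
    (hM : IsCQBounded s M) : IsCQBounded s (handOver M) := by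
  obtain ⟨N, rfl, hN, htr, σ, hσ, hle⟩ := hM
  refine ⟨_, handOver_cqBlock N, fun c => (hN c).submatrix _, ?_, traceSnd σ,
    ⟨traceSnd_posSemidef hσ.1, by rw [trace_traceSnd, hσ.2]⟩, fun c => ?_⟩
  · rw [← htr]
    refine Finset.sum_congr rfl fun c _ => ?_
    rw [← trace_traceFst, traceFst_handOver, trace_traceSnd, trace_traceFst]
  · rw [traceFst_handOver, ← traceSnd_smul_sub]
    exact traceSnd_posSemidef (hle c)

end IsCQBounded

/-! ### From the invariant to min-entropy. -/

/-- The set whose infimum is the negative of the conditional min-entropy. -/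
def minEntropySet {A B : Type} [Fintype A] [DecidableEq A] [Fintype B]
    (ρ : Matrix (A × B) (A × B) ℂ) : Set ℝ :=
  {l : ℝ | ∃ σ : Matrix B B ℂ, IsDensity σ ∧
    ((((2 : ℝ) ^ l : ℝ) : ℂ) • ((1 : Matrix A A ℂ) ⊗ₖ σ) - ρ).PosSemidef}

section MinEntropy

variable {C A B : Type} [Fintype C] [DecidableEq C] [Fintype A] [Fintype B]

lemma IsCQBounded.mem_minEntropySet {l : ℝ} {M : Matrix (C × A × B) (C × A × B) ℂ}
    (hM : IsCQBounded ((2 : ℝ) ^ l) M) : l ∈ minEntropySet (traceAlice M) := by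
  obtain ⟨N, rfl, hN, htr, σ, hσ, hle⟩ := hM
  refine ⟨σ, hσ, ?_⟩
  rw [traceAlice_cqBlock, smul_one_kronecker_sub_cqBlock]
  exact posSemidef_cqBlock hle

/-- Taking traces gives `1 ≤ 2 ^ l * card C`. -/
lemma bddBelow_minEntropySet {ρ : Matrix (C × B) (C × B) ℂ} (hρ : ρ.trace = 1) :
    BddBelow (minEntropySet ρ) := by
  refine ⟨Real.logb 2 (Fintype.card C : ℝ)⁻¹, ?_⟩
  rintro l ⟨σ, hσ, h⟩
  have h := h.trace_nonneg
  rw [Matrix.trace_sub, Matrix.trace_smul, Matrix.trace_kronecker, Matrix.trace_one, hσ.2, hρ,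
    mul_one, smul_eq_mul, sub_nonneg] at h
  have h : (1 : ℝ) ≤ 2 ^ l * Fintype.card C := by exact_mod_cast h
  have hC : (0 : ℝ) < Fintype.card C := by
    refine lt_of_le_of_ne (Nat.cast_nonneg _) fun h0 => ?_
    rw [← h0] at h
    norm_num at h
  rw [Real.logb_le_iff_le_rpow one_lt_two (inv_pos.mpr hC), inv_le_iff_one_le_mul₀ hC]
  exact h

lemma trace_traceAlice_cqBlock (N : C → Matrix (A × B) (A × B) ℂ) :
    (traceAlice (cqBlock N)).trace = ∑ c, (N c).trace := by
  simp only [traceAlice_cqBlock, trace_cqBlock, trace_traceFst]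

/-- The min-entropy of a cq-state decreases by at most `t` if every bound on the state gives a bound
on the final state that is larger by the factor `2 ^ t`. -/
lemma minEntropy_sub_le {A' B' : Type} [Fintype A'] [Fintype B']
    {N : C → Matrix (A × B) (A × B) ℂ} (hN : ∀ c, (N c).PosSemidef) (htr : ∑ c, (N c).trace = 1)
    {M' : Matrix (C × A' × B') (C × A' × B') ℂ} {t : ℝ}
    (h : ∀ s : ℝ, IsCQBounded s (cqBlock N) → IsCQBounded (s * 2 ^ t) M') :
    minEntropy (traceAlice (cqBlock N)) - t ≤ minEntropy (traceAlice M') := by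
  -- Bob's total marginal, the sum over all blocks, dominates each block. This makes the initial set
  -- nonempty and, through `h`, shows that `M'` has trace one, so that its set is bounded below.
  have h0 : IsCQBounded 1 (cqBlock N) := by
    refine ⟨N, rfl, hN, htr, ∑ c, traceFst (N c),
      ⟨Matrix.posSemidef_sum _ fun c _ => traceFst_posSemidef (hN c), ?_⟩, fun c => ?_⟩
    · rw [Matrix.trace_sum]
      simpa only [trace_traceFst]
    · rw [Complex.ofReal_one, one_smul, ← Finset.sum_erase_add _ _ (Finset.mem_univ c),
        add_sub_cancel_right]
      exact Matrix.posSemidef_sum _ fun c _ => traceFst_posSemidef (hN c)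
  have hb : BddBelow (minEntropySet (traceAlice M')) := by
    obtain ⟨N', rfl, -, htr', -⟩ := h 1 h0
    exact bddBelow_minEntropySet (by rw [trace_traceAlice_cqBlock, htr'])
  have hne : (minEntropySet (traceAlice (cqBlock N))).Nonempty :=
    ⟨0, IsCQBounded.mem_minEntropySet (by simpa using h0)⟩
  have key : sInf (minEntropySet (traceAlice M')) - t ≤
      sInf (minEntropySet (traceAlice (cqBlock N))) := by
    refine le_csInf hne ?_
    rintro l ⟨σ, hσ, hl⟩
    rw [traceAlice_cqBlock, smul_one_kronecker_sub_cqBlock] at hl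
    have := h (2 ^ l)
      ⟨N, rfl, hN, htr, σ, hσ, posSemidef_block_of_posSemidef_cqBlock hl⟩
    rw [← Real.rpow_add two_pos] at this
    linarith [csInf_le hb this.mem_minEntropySet]
  change -sInf (minEntropySet _) - t ≤ -sInf (minEntropySet _)
  linarith

end MinEntropy

/-! ### The initial state. -/

section Initial

variable {C B : Type} [Fintype C] [DecidableEq C] [Fintype B]

lemma trace_eprPairs (m : ℕ) : (eprPairs m).trace = 1 := by
  have h2 : ((Real.sqrt 2 : ℝ) : ℂ)⁻¹ * ((Real.sqrt 2 : ℝ) : ℂ)⁻¹ = 2⁻¹ := by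
    rw [← mul_inv, ← Complex.ofReal_mul, Real.mul_self_sqrt zero_le_two, Complex.ofReal_ofNat]
  simp only [eprPairs, Matrix.trace_vecMulVec, dotProduct, Pi.star_apply, Fintype.sum_prod_type,
    star_prod, ← Finset.prod_mul_distrib]
  have h1 : ∀ x : Qubits m,
      ∑ y : Qubits m, ∏ k, eprVector (x k, y k) * star (eprVector (x k, y k)) = (2⁻¹ : ℂ) ^ m := by
    intro x
    rw [← Fintype.prod_sum fun k j => eprVector (x k, j) * star (eprVector (x k, j))]
    have : ∀ i : Fin 2, ∑ j, eprVector (i, j) * star (eprVector (i, j)) = 2⁻¹ := by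
      intro i
      rw [Finset.sum_eq_single i]
      · simp [eprVector, h2]
      · intro j _ hj
        simp [eprVector, hj.symm]
      · simp
    simp only [this, Finset.prod_const, Finset.card_univ, Fintype.card_fin]
  simp only [h1]
  simp

/-- The initial state is a cq-state with `C` classical. -/
lemma exists_initialState_eq_cqBlock (m : ℕ) {ρ : Matrix (C × B) (C × B) ℂ} (hρ : IsCQState ρ) :
    ∃ N : C → Matrix (Qubits m × (B × Qubits m)) (Qubits m × (B × Qubits m)) ℂ,
      initialState m ρ = cqBlock N ∧ (∀ c, (N c).PosSemidef) ∧ ∑ c, (N c).trace = 1 := by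
  obtain ⟨p, ρB, hp, hρB, rfl⟩ := hρ
  have heq : initialState m (cqOperator p ρB) = cqBlock fun c =>
      (eprPairs m ⊗ₖ ((p c : ℂ) • ρB c)).submatrix (fun x => ((x.1, x.2.2), x.2.1))
        fun x => ((x.1, x.2.2), x.2.1) := by
    rw [cqOperator_eq_cqBlock]
    ext ⟨c, x⟩ ⟨c', x'⟩
    by_cases h : c = c' <;> simp [initialState, cqBlock_apply, h]
  refine ⟨_, heq, fun c => ?_, ?_⟩
  · refine Matrix.PosSemidef.submatrix (Matrix.PosSemidef.kronecker ?_ ?_) _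
    · exact Matrix.posSemidef_vecMulVec_self_star _
    · exact (hρB c).1.smul (by exact_mod_cast hp.1 c)
  · have htr : ∀ M : Matrix ((Qubits m × Qubits m) × B) ((Qubits m × Qubits m) × B) ℂ,
        (M.submatrix (fun x : Qubits m × (B × Qubits m) => ((x.1, x.2.2), x.2.1))
          fun x => ((x.1, x.2.2), x.2.1)).trace = M.trace := fun M => by
      simp only [Matrix.trace, Matrix.diag_apply, Matrix.submatrix_apply, Fintype.sum_prod_type]
      exact Finset.sum_congr rfl fun x _ => Finset.sum_comm
    simp only [htr, Matrix.trace_kronecker, trace_eprPairs, Matrix.trace_smul, (hρB _).2, one_mul,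
      smul_eq_mul, mul_one]
    exact_mod_cast hp.2

end Initial

/-! ### Induction over the rounds. -/

namespace Protocol

variable {C A₀ B₀ : Type} [Fintype C] [DecidableEq C] [Fintype A₀] [DecidableEq A₀]
  [Fintype B₀] [DecidableEq B₀] {n : ℕ}

lemma isCQBounded_aliceStep (P : Protocol C A₀ B₀ n) {s : ℝ}
    {M : Matrix (C × A₀ × B₀) (C × A₀ × B₀) ℂ} {k : ℕ} (hk : k ≤ n) {t : ℝ}
    (hM : IsCQBounded (s * 2 ^ t) (P.stateAfter M k)) :
    IsCQBounded (s * 2 ^ (t + 2 * Real.logb 2 (P.dX (k + 1))))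
      (aliceStep (P.Φ k) (P.stateAfter M k)) := by
  obtain ⟨hX, h⟩ := hM.aliceStep (P.controlled k hk)
  -- Positivity is needed to recover the dimension as `2 ^ logb 2 d`; at `d = 0` the default `logb 2
  -- 0 = 0` would break this.
  have hd : (0 : ℝ) < P.dX (k + 1) := by
    exact_mod_cast Fin.pos_iff_nonempty.mpr hX
  convert h using 1
  rw [Fintype.card_fin, Real.rpow_add two_pos, mul_comm (2 : ℝ) (Real.logb _ _),
    Real.rpow_mul zero_le_two, Real.rpow_logb two_pos (by norm_num) hd, Real.rpow_two]
  ring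

lemma isCQBounded_stateAfter (P : Protocol C A₀ B₀ n) {s : ℝ}
    {M : Matrix (C × A₀ × B₀) (C × A₀ × B₀) ℂ} (hM : IsCQBounded s M) {k : ℕ} (hk : k ≤ n) :
    IsCQBounded (s * 2 ^ (2 * ∑ i ∈ Finset.range k, Real.logb 2 (P.dX (i + 1))))
      (P.stateAfter M k) := by
  induction k with
  | zero =>
    simp only [Finset.range_zero, Finset.sum_empty, mul_zero, Real.rpow_zero, mul_one]
    exact hM
  | succ k ih =>
    rw [Finset.sum_range_succ, mul_add]
    exact ((P.isCQBounded_aliceStep (by omega) (ih (by omega))).bobStep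
      (P.cptp k (by omega))).handOver

lemma isCQBounded_run (P : Protocol C A₀ B₀ n) {s : ℝ}
    {M : Matrix (C × A₀ × B₀) (C × A₀ × B₀) ℂ} (hM : IsCQBounded s M) :
    IsCQBounded (s * 2 ^ (2 * P.commA)) (P.run M) := by
  rw [commA, Finset.sum_range_succ, mul_add]
  exact (P.isCQBounded_aliceStep le_rfl (P.isCQBounded_stateAfter hM le_rfl)).bobStep
    P.cptp_last

end Protocol

end LeakageChain

theorem mainTheorem2
    {C B : Type} [Fintype C] [DecidableEq C] [Fintype B] [DecidableEq B]
    (m n : ℕ) (mA mB : ℝ)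
    (ρ : Matrix (C × B) (C × B) ℂ) (hρ : LeakageChain.IsCQState ρ)
    (P : LeakageChain.Protocol C (LeakageChain.Qubits m) (B × LeakageChain.Qubits m) n)
    (hA : P.commA = mA) (hB : P.commB = mB) (hm : mA ≤ m) :
    LeakageChain.minEntropy
        (LeakageChain.traceAlice (P.run (LeakageChain.initialState m ρ))) ≥
      LeakageChain.minEntropy
        (LeakageChain.traceAlice (LeakageChain.initialState m ρ)) - 2 * mA := by
  obtain ⟨N, hN, hpos, htr⟩ := LeakageChain.exists_initialState_eq_cqBlock m hρ
  rw [hN, ← hA]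
  exact LeakageChain.minEntropy_sub_le hpos htr fun s h => P.isCQBounded_run h
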